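/- Let $n\ge 1$ and let $\|\cdot\|$ be the Euclidean norm on $\mathbb{R}^n$. For $f:\mathbb{R}^n\to\mathbb{R}$, a sequence $(x_k)_{k\ge 0}$ in $\mathbb{R}^n$ is called a BFGS sequence for $f$ if $f$ is differentiable at each $x_k$ with $\nabla f(x_k)\neq 0$, and there exist parameters $0<\mu<\nu<1$ and a (symmetric) positive definite $n\times n$ matrix $H_0$ such that the vectors $$s_k=x_{k+1}-x_k,\qquad y_k=\nabla f(x_{k+1})-\nabla f(x_k)$$ and the matrices defined recursively by $$V_k=I-\frac{s_ky_k^T}{s_k^Ty_k},\qquad H_{k+1}=V_kH_kV_k^T+\frac{s_ks_k^T}{s_k^Ty_k}$$ satisfy, for all $k=0,1,2,\dots$, $$H_k\nabla f(x_k)\in-\mathbb{R}_+s_k,\qquad f(x_{k+1})\le f(x_k)+\mu\nabla f(x_k)^Ts_k,\qquad \nabla f(x_{k+1})^Ts_k\ge\nu\nabla f(x_k)^Ts_k .$$ (These conditions imply $s_k^Ty_k>0$ for all $k$, so the recursion is well defined.) Then every BFGS sequence $(x_k)$ for the function $f=\|\cdot\|$ on $\mathbb{R}^n$ converges to $0$.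 -/

import Mathlib

open scoped Matrix

namespace BFGS

/-- The matrix `V = I - s yᵀ / (sᵀ y)`. -/
noncomputable def updateFactor {n : ℕ} (s y : EuclideanSpace ℝ (Fin n)) :
    Matrix (Fin n) (Fin n) ℝ :=
  1 - (s.ofLp ⬝ᵥ y.ofLp)⁻¹ • Matrix.vecMulVec s.ofLp y.ofLp

/-- The BFGS update of an approximate inverse Hessian:
`H₊ = V H Vᵀ + s sᵀ / (sᵀ y)`. -/
noncomputable def update {n : ℕ} (s y : EuclideanSpace ℝ (Fin n))
    (H : Matrix (Fin n) (Fin n) ℝ) : Matrix (Fin n) (Fin n) ℝ :=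
  updateFactor s y * H * (updateFactor s y)ᵀ
    + (s.ofLp ⬝ᵥ y.ofLp)⁻¹ • Matrix.vecMulVec s.ofLp s.ofLp

/-- The step `s_k = x_{k+1} - x_k`. -/
def step {n : ℕ} (x : ℕ → EuclideanSpace ℝ (Fin n)) (k : ℕ) : EuclideanSpace ℝ (Fin n) :=
  x (k + 1) - x k

/-- The gradient difference `y_k = ∇f(x_{k+1}) - ∇f(x_k)`. -/
noncomputable def gradDiff {n : ℕ} (f : EuclideanSpace ℝ (Fin n) → ℝ)
    (x : ℕ → EuclideanSpace ℝ (Fin n)) (k : ℕ) : EuclideanSpace ℝ (Fin n) :=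
  gradient f (x (k + 1)) - gradient f (x k)

/-- The approximate inverse Hessians `H_k`, generated from `H₀` by the BFGS update. -/
noncomputable def invHessian {n : ℕ} (f : EuclideanSpace ℝ (Fin n) → ℝ)
    (x : ℕ → EuclideanSpace ℝ (Fin n)) (H₀ : Matrix (Fin n) (Fin n) ℝ) :
    ℕ → Matrix (Fin n) (Fin n) ℝ
  | 0 => H₀
  | k + 1 => update (step x k) (gradDiff f x k) (invHessian f x H₀ k)

/-- `x` is a BFGS sequence for `f : ℝⁿ → ℝ`: `f` is differentiable with nonzero gradient at each
iterate, and for some `0 < μ < ν < 1` and some positive definite `H₀`, every step is in the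
quasi-Newton direction, `H_k ∇f(x_k) ∈ -ℝ₊ s_k`, and satisfies the Armijo and weak Wolfe
conditions.  (No separate requirement `s_kᵀ y_k ≠ 0` is needed in order that the divisions in the
update make sense: the conditions below force `s_kᵀ y_k > 0`.) -/
def IsBFGSSequence {n : ℕ} (f : EuclideanSpace ℝ (Fin n) → ℝ)
    (x : ℕ → EuclideanSpace ℝ (Fin n)) : Prop :=
  (∀ k, DifferentiableAt ℝ f (x k) ∧ gradient f (x k) ≠ 0) ∧
  ∃ (μ ν : ℝ) (H₀ : Matrix (Fin n) (Fin n) ℝ), 0 < μ ∧ μ < ν ∧ ν < 1 ∧ H₀.PosDef ∧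
    ∀ k,
      (∃ t : ℝ, 0 ≤ t ∧
        invHessian f x H₀ k *ᵥ (gradient f (x k)).ofLp = -(t • (step x k).ofLp)) ∧
      f (x (k + 1)) ≤ f (x k) + μ * inner ℝ (gradient f (x k)) (step x k) ∧
      ν * inner ℝ (gradient f (x k)) (step x k) ≤ inner ℝ (gradient f (x (k + 1))) (step x k)

end BFGS

/-! The Armijo condition makes `‖x k‖` decrease to some `r ≥ 0`; suppose `r > 0`. The decrements of
the norm tend to 0, hence so does `δ = -gᵀs`. The identity `2 sᵀy = (‖x‖ + ‖z‖) ‖y‖²` for a step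
from `x` to `z` bounds `yᵀy / sᵀy` by `1 / r`. The potential `tr B - log det B` of `B = H⁻¹` changes
in each step by at most `yᵀy / sᵀy - log (1 - ν) - 1 + log δ`, which tends to `-∞`, yet the
potential is never negative: a contradiction. -/

namespace BFGS

open Matrix

variable {n : ℕ}

/-- The BFGS update of an approximate Hessian, dual to `update`. -/
noncomputable def dualUpdate (s y : Fin n → ℝ) (B : Matrix (Fin n) (Fin n) ℝ) :
    Matrix (Fin n) (Fin n) ℝ :=
  B - (s ⬝ᵥ B *ᵥ s)⁻¹ • vecMulVec (B *ᵥ s) (B *ᵥ s) + (s ⬝ᵥ y)⁻¹ • vecMulVec y y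

theorem dualUpdate_mul_update (s y : EuclideanSpace ℝ (Fin n)) {B H : Matrix (Fin n) (Fin n) ℝ}
    (hBH : B * H = 1) (hB : Bᵀ = B) (hsy : s.ofLp ⬝ᵥ y.ofLp ≠ 0)
    (hsB : s.ofLp ⬝ᵥ B *ᵥ s.ofLp ≠ 0) :
    dualUpdate s.ofLp y.ofLp B * update s y H = 1 := by
  unfold dualUpdate update updateFactor
  generalize s.ofLp = s at *
  generalize y.ofLp = y at *
  have hbH : (B *ᵥ s) ᵥ* H = s := by
    rw [← hB, mulVec_transpose, vecMul_vecMul, hBH, vecMul_one]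
  have hsb : (B *ᵥ s) ⬝ᵥ s = s ⬝ᵥ B *ᵥ s := dotProduct_comm _ _
  have hys : y ⬝ᵥ s = s ⬝ᵥ y := dotProduct_comm _ _
  generalize hb : B *ᵥ s = b at *
  have hBs : ∀ z : Fin n → ℝ, B * vecMulVec s z = vecMulVec b z := fun z => by rw [mul_vecMulVec, hb]
  -- The factor `V` satisfies `yᵀV = 0`, which kills the `y yᵀ` term; the `b yᵀ` terms cancel.
  have h₁ : (B - (s ⬝ᵥ b)⁻¹ • vecMulVec b b + (s ⬝ᵥ y)⁻¹ • vecMulVec y y) *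
      (1 - (s ⬝ᵥ y)⁻¹ • vecMulVec s y) = B - (s ⬝ᵥ b)⁻¹ • vecMulVec b b := by
    simp only [mul_sub, add_mul, sub_mul, mul_one, smul_mul_assoc, Matrix.mul_smul, hBs,
      vecMulVec_mul_vecMulVec, hsb, hys, smul_smul, vecMulVec_smul]
    match_scalars <;> field_simp <;> ring
  have h₂ : (B - (s ⬝ᵥ b)⁻¹ • vecMulVec b b) * H = 1 - (s ⬝ᵥ b)⁻¹ • vecMulVec b s := by
    rw [sub_mul, smul_mul, vecMulVec_mul, hbH, hBH]
  rw [mul_add, ← mul_assoc, ← mul_assoc, h₁, h₂]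
  simp only [transpose_sub, transpose_one, transpose_smul, transpose_vecMulVec, mul_sub, add_mul,
    sub_mul, mul_one, one_mul, smul_mul_assoc, Matrix.mul_smul, hBs,
    vecMulVec_mul_vecMulVec, hsb, hys, smul_smul, vecMulVec_smul]
  match_scalars <;> field_simp <;> ring

theorem trace_dualUpdate (s y : Fin n → ℝ) (B : Matrix (Fin n) (Fin n) ℝ) :
    (dualUpdate s y B).trace =
      B.trace - (B *ᵥ s ⬝ᵥ B *ᵥ s) / (s ⬝ᵥ B *ᵥ s) + (y ⬝ᵥ y) / (s ⬝ᵥ y) := by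
  simp only [dualUpdate, trace_add, trace_sub, trace_smul, trace_vecMulVec, smul_eq_mul]
  ring

/-- The update is a rank-two perturbation `B (1 + U W)`, and `det (1 + U W) = det (1 + W U)` is a 2
× 2 determinant whose upper left entry is 0. -/
theorem det_dualUpdate {s y : Fin n → ℝ} {B : Matrix (Fin n) (Fin n) ℝ}
    (hB : Bᵀ = B) (hdet : IsUnit B.det) (hsy : s ⬝ᵥ y ≠ 0) (hsB : s ⬝ᵥ B *ᵥ s ≠ 0) :
    (dualUpdate s y B).det = B.det * ((s ⬝ᵥ y) / (s ⬝ᵥ B *ᵥ s)) := by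
  have hBB : B * B⁻¹ = 1 := mul_nonsing_inv B hdet
  let U : Matrix (Fin n) (Fin 2) ℝ := of fun i => ![s i, (B⁻¹ *ᵥ y) i]
  let W : Matrix (Fin 2) (Fin n) ℝ :=
    of ![-(s ⬝ᵥ B *ᵥ s)⁻¹ • (B *ᵥ s), (s ⬝ᵥ y)⁻¹ • y]
  have hfac : dualUpdate s y B = B * (1 + U * W) := by
    have hUW : U * W = (s ⬝ᵥ y)⁻¹ • vecMulVec (B⁻¹ *ᵥ y) y
        - (s ⬝ᵥ B *ᵥ s)⁻¹ • vecMulVec s (B *ᵥ s) := by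
      ext i j
      simp [U, W, mul_apply, Fin.sum_univ_two, vecMulVec_apply]
      ring
    rw [hUW, mul_add, mul_sub, Matrix.mul_smul, Matrix.mul_smul, mul_vecMulVec, mul_vecMulVec,
      mulVec_mulVec, hBB, one_mulVec, mul_one, dualUpdate]
    abel
  have hentry : ∀ i j, (W * U) i j = W i ⬝ᵥ U.col j := fun i j => rfl
  have hU0 : U.col 0 = s := rfl
  have hU1 : U.col 1 = B⁻¹ *ᵥ y := rfl
  have hbs : (B *ᵥ s) ⬝ᵥ s = s ⬝ᵥ B *ᵥ s := dotProduct_comm _ _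
  have hby : (B *ᵥ s) ⬝ᵥ (B⁻¹ *ᵥ y) = s ⬝ᵥ y := by
    nth_rw 1 [← hB]
    rw [mulVec_transpose, ← dotProduct_mulVec, mulVec_mulVec, hBB, one_mulVec]
  have hys : y ⬝ᵥ s = s ⬝ᵥ y := dotProduct_comm _ _
  have hW0 : W 0 = -(s ⬝ᵥ B *ᵥ s)⁻¹ • (B *ᵥ s) := rfl
  have hW1 : W 1 = (s ⬝ᵥ y)⁻¹ • y := rfl
  rw [hfac, det_mul, det_one_add_mul_comm, det_fin_two]
  simp only [Matrix.add_apply, hentry, hU0, hU1, hW0, hW1, smul_dotProduct, hbs, hby, hys, smul_eq_mul]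
  congr 1
  simp
  field_simp
  ring

/-- The update is visibly positive semidefinite, and the dual update inverts it. -/
theorem posDef_update {s y : EuclideanSpace ℝ (Fin n)} {H : Matrix (Fin n) (Fin n) ℝ}
    (hH : H.PosDef) (hsy : 0 < s.ofLp ⬝ᵥ y.ofLp) (hs : s.ofLp ≠ 0) :
    (update s y H).PosDef ∧ (update s y H)⁻¹ = dualUpdate s.ofLp y.ofLp H⁻¹ := by
  have hpos : 0 < s.ofLp ⬝ᵥ H⁻¹ *ᵥ s.ofLp := by
    simpa using hH.inv.dotProduct_mulVec_pos hs
  have hinv := dualUpdate_mul_update s y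
    (nonsing_inv_mul H ((isUnit_iff_isUnit_det H).1 hH.isUnit))
    (by simpa using hH.inv.isHermitian.eq) hsy.ne' hpos.ne'
  refine ⟨?_, inv_eq_left_inv hinv⟩
  have hpsd : (update s y H).PosSemidef := by
    refine PosSemidef.add ?_ (PosSemidef.smul ?_ (inv_nonneg.2 hsy.le))
    · simpa using hH.posSemidef.mul_mul_conjTranspose_same (updateFactor s y)
    · simpa using posSemidef_vecMulVec_self_star s.ofLp
  exact hpsd.posDef_iff_isUnit.2 (.of_mul_eq_one _ (mul_eq_one_comm.1 hinv))

/-- The Byrd–Nocedal potential `tr B - log det B` of `B = H⁻¹`. -/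
noncomputable def potential (H : Matrix (Fin n) (Fin n) ℝ) : ℝ :=
  H⁻¹.trace - Real.log H⁻¹.det

/-- Each eigenvalue `λ` of `H⁻¹` contributes `λ - log λ ≥ 1`. -/
theorem potential_nonneg {H : Matrix (Fin n) (Fin n) ℝ} (hH : H.PosDef) : 0 ≤ potential H := by
  have hB := hH.inv
  rw [potential, hB.isHermitian.trace_eq_sum_eigenvalues, hB.isHermitian.det_eq_prod_eigenvalues]
  simp only [RCLike.ofReal_real_eq_id, id_eq]
  rw [Real.log_prod fun i _ => (hB.eigenvalues_pos i).ne', ← Finset.sum_sub_distrib]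
  refine Finset.sum_nonneg fun i _ => ?_
  linarith [Real.log_le_sub_one_of_pos (hB.eigenvalues_pos i)]

theorem potential_update {s y : EuclideanSpace ℝ (Fin n)} {H : Matrix (Fin n) (Fin n) ℝ}
    (hH : H.PosDef) (hsy : 0 < s.ofLp ⬝ᵥ y.ofLp) (hs : s.ofLp ≠ 0) :
    potential (update s y H) = potential H
      - (H⁻¹ *ᵥ s.ofLp ⬝ᵥ H⁻¹ *ᵥ s.ofLp) / (s.ofLp ⬝ᵥ H⁻¹ *ᵥ s.ofLp)
      + (y.ofLp ⬝ᵥ y.ofLp) / (s.ofLp ⬝ᵥ y.ofLp)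
      - Real.log ((s.ofLp ⬝ᵥ y.ofLp) / (s.ofLp ⬝ᵥ H⁻¹ *ᵥ s.ofLp)) := by
  have hpos : 0 < s.ofLp ⬝ᵥ H⁻¹ *ᵥ s.ofLp := by
    simpa using hH.inv.dotProduct_mulVec_pos hs
  rw [potential, (posDef_update hH hsy hs).2, trace_dualUpdate,
    det_dualUpdate (by simpa using hH.inv.isHermitian.eq) hH.inv.det_pos.ne'.isUnit hsy.ne' hpos.ne',
    Real.log_mul hH.inv.det_pos.ne' (div_pos hsy hpos).ne', potential]
  ring

/-- The decrease of the potential along a quasi-Newton step with unit gradient `g` satisfying the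
weak Wolfe condition. -/
theorem potential_update_le {s y g : EuclideanSpace ℝ (Fin n)} {H : Matrix (Fin n) (Fin n) ℝ}
    {t ν : ℝ} (hH : H.PosDef) (hg : g.ofLp ⬝ᵥ g.ofLp = 1) (ht : 0 ≤ t)
    (hHg : H *ᵥ g.ofLp = -(t • s.ofLp)) (hν : ν < 1)
    (hwolfe : (1 - ν) * -(g.ofLp ⬝ᵥ s.ofLp) ≤ s.ofLp ⬝ᵥ y.ofLp) :
    0 < -(g.ofLp ⬝ᵥ s.ofLp) ∧ 0 < s.ofLp ⬝ᵥ y.ofLp ∧ (update s y H).PosDef ∧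
      potential (update s y H) ≤ potential H + (y.ofLp ⬝ᵥ y.ofLp) / (s.ofLp ⬝ᵥ y.ofLp)
        - Real.log (1 - ν) - 1 + Real.log (-(g.ofLp ⬝ᵥ s.ofLp)) := by
  have hg0 : g.ofLp ≠ 0 := by
    intro h
    simp [h] at hg
  have hgHg : 0 < t * -(g.ofLp ⬝ᵥ s.ofLp) := by
    have := hH.dotProduct_mulVec_pos hg0
    rw [hHg] at this
    simpa using this
  have ht0 : 0 < t := ht.lt_of_ne (by rintro rfl; simp at hgHg)
  have hδ : 0 < -(g.ofLp ⬝ᵥ s.ofLp) := pos_of_mul_pos_right hgHg ht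
  have hsy : 0 < s.ofLp ⬝ᵥ y.ofLp := (mul_pos (sub_pos.2 hν) hδ).trans_le hwolfe
  have hs : s.ofLp ≠ 0 := by
    intro h
    simp [h] at hsy
  have hb : H⁻¹ *ᵥ s.ofLp = -(t⁻¹ • g.ofLp) := by
    have h := congrArg (H⁻¹ *ᵥ ·) hHg
    simp only [mulVec_mulVec, nonsing_inv_mul H ((isUnit_iff_isUnit_det H).1 hH.isUnit),
      one_mulVec, mulVec_neg, mulVec_smul] at h
    rw [h, smul_neg, neg_neg, smul_smul, inv_mul_cancel₀ ht0.ne', one_smul]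
  refine ⟨hδ, hsy, (posDef_update hH hsy hs).1, ?_⟩
  rw [potential_update hH hsy hs, hb]
  have hbb : -(t⁻¹ • g.ofLp) ⬝ᵥ -(t⁻¹ • g.ofLp) = t⁻¹ * t⁻¹ := by
    simp [hg]
  have hsb : s.ofLp ⬝ᵥ -(t⁻¹ • g.ofLp) = t⁻¹ * -(g.ofLp ⬝ᵥ s.ofLp) := by
    simp [dotProduct_comm]
  rw [hbb, hsb]
  generalize -(g.ofLp ⬝ᵥ s.ofLp) = δ at *
  generalize s.ofLp ⬝ᵥ y.ofLp = σ at *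
  have hlog : Real.log (1 - ν) + Real.log t ≤ Real.log (σ / (t⁻¹ * δ)) := by
    rw [← Real.log_mul (sub_pos.2 hν).ne' ht0.ne']
    refine Real.log_le_log (mul_pos (sub_pos.2 hν) ht0) ?_
    rw [le_div_iff₀ (by positivity)]
    calc (1 - ν) * t * (t⁻¹ * δ) = (1 - ν) * δ := by field_simp
      _ ≤ σ := hwolfe
  -- `log u ≤ u - 1` at `u = (t δ)⁻¹`; this eliminates the uncontrolled scale `t`.
  have hamgm : -Real.log t - Real.log δ ≤ t⁻¹ * t⁻¹ / (t⁻¹ * δ) - 1 := by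
    have h := Real.log_le_sub_one_of_pos (inv_pos.2 (mul_pos ht0 hδ))
    rw [Real.log_inv, Real.log_mul ht0.ne' hδ.ne'] at h
    have : t⁻¹ * t⁻¹ / (t⁻¹ * δ) = (t * δ)⁻¹ := by field_simp
    linarith
  linarith

theorem gradient_norm_of_ne_zero {E : Type*} [NormedAddCommGroup E]
    [InnerProductSpace ℝ E] [CompleteSpace E] {x : E} (hx : x ≠ 0) :
    gradient (fun z : E => ‖z‖) x = ‖x‖⁻¹ • x := by
  have hx' : ‖x‖ ≠ 0 := norm_ne_zero_iff.2 hx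
  have h := (hasStrictFDerivAt_norm_sq x).hasFDerivAt.sqrt (pow_ne_zero 2 hx')
  simp only [Real.sqrt_sq (norm_nonneg _)] at h
  refine HasGradientAt.gradient (hasGradientAt_iff_hasFDerivAt.2 (h.congr_fderiv ?_))
  ext v
  simp
  field_simp

/-- For the norm, the curvature ratio of a step is determined by the radii. -/
theorem inner_sub_normalize_sub {E : Type*} [NormedAddCommGroup E] [InnerProductSpace ℝ E]
    {x z : E} (hx : x ≠ 0) (hz : z ≠ 0) :
    2 * inner ℝ (z - x) (‖z‖⁻¹ • z - ‖x‖⁻¹ • x) =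
      (‖x‖ + ‖z‖) * ‖‖z‖⁻¹ • z - ‖x‖⁻¹ • x‖ ^ 2 := by
  have hx' : ‖x‖ ≠ 0 := norm_ne_zero_iff.2 hx
  have hz' : ‖z‖ ≠ 0 := norm_ne_zero_iff.2 hz
  rw [← real_inner_self_eq_norm_sq]
  simp only [inner_sub_left, inner_sub_right, real_inner_smul_left, real_inner_smul_right,
    real_inner_self_eq_norm_sq, real_inner_comm x z, norm_smul, norm_inv, norm_norm,
    inv_mul_cancel₀ hx', inv_mul_cancel₀ hz']
  field_simp
  ring

theorem ne_zero_of_gradient_norm_ne_zero {E : Type*} [NormedAddCommGroup E]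
    [InnerProductSpace ℝ E] [CompleteSpace E] {x : E}
    (h : gradient (fun z : E => ‖z‖) x ≠ 0) : x ≠ 0 := by
  rintro rfl
  -- The norm fails to be differentiable at 0 only in a nontrivial space; `gradient` then takes its
  -- default value 0.
  have : Nontrivial E := ⟨_, _, h⟩
  exact h (gradient_eq_zero_of_not_differentiableAt (not_differentiableAt_norm_zero E))

end BFGS

open Filter Topology

theorem mainTheorem2 (n : ℕ) (x : ℕ → EuclideanSpace ℝ (Fin n))
    (hx : BFGS.IsBFGSSequence (fun z : EuclideanSpace ℝ (Fin n) => ‖z‖) x) :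
    Filter.Tendsto x Filter.atTop (nhds 0) := by
  obtain ⟨hgrad, μ, ν, H₀, hμ, -, hν, hH₀, hstep⟩ := hx
  have hx0 : ∀ k, x k ≠ 0 := fun k => BFGS.ne_zero_of_gradient_norm_ne_zero (hgrad k).2
  have hg : ∀ k, gradient (fun z : EuclideanSpace ℝ (Fin n) => ‖z‖) (x k) = ‖x k‖⁻¹ • x k :=
    fun k => BFGS.gradient_norm_of_ne_zero (hx0 k)
  set f : EuclideanSpace ℝ (Fin n) → ℝ := fun z => ‖z‖ with hf
  set H := BFGS.invHessian f x H₀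
  set g : ℕ → EuclideanSpace ℝ (Fin n) := fun k => gradient f (x k) with hgdef
  set s := BFGS.step x
  set y := BFGS.gradDiff f x
  have hinner : ∀ u v : EuclideanSpace ℝ (Fin n), inner ℝ u v = u.ofLp ⬝ᵥ v.ofLp := fun u v => by
    rw [EuclideanSpace.inner_eq_star_dotProduct, star_trivial, dotProduct_comm]
  have hgg : ∀ k, (g k).ofLp ⬝ᵥ (g k).ofLp = 1 := fun k => by
    have : ‖x k‖ ≠ 0 := norm_ne_zero_iff.2 (hx0 k)
    rw [← hinner, real_inner_self_eq_norm_sq, hgdef]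
    simp only [hg, norm_smul, norm_inv, norm_norm]
    field_simp
  have hwolfe : ∀ k, (1 - ν) * -((g k).ofLp ⬝ᵥ (s k).ofLp) ≤ (s k).ofLp ⬝ᵥ (y k).ofLp := fun k => by
    have h := (hstep k).2.2
    have hyk : y k = g (k + 1) - g k := rfl
    rw [← hinner, ← hinner, hyk, real_inner_comm _ (s k), inner_sub_left]
    linarith
  have hdecr : ∀ k, (H k).PosDef → 0 < -((g k).ofLp ⬝ᵥ (s k).ofLp) ∧
      0 < (s k).ofLp ⬝ᵥ (y k).ofLp ∧ (H (k + 1)).PosDef ∧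
      BFGS.potential (H (k + 1)) ≤ BFGS.potential (H k)
        + ((y k).ofLp ⬝ᵥ (y k).ofLp) / ((s k).ofLp ⬝ᵥ (y k).ofLp)
        - Real.log (1 - ν) - 1 + Real.log (-((g k).ofLp ⬝ᵥ (s k).ofLp)) := fun k hk => by
    obtain ⟨t, ht, hHg⟩ := (hstep k).1
    exact BFGS.potential_update_le hk (hgg k) ht hHg hν (hwolfe k)
  have hpd : ∀ k, (H k).PosDef := fun k => by
    induction k with
    | zero => exact hH₀
    | succ k ih => exact (hdecr k ih).2.2.1
  have hδ : ∀ k, 0 < -((g k).ofLp ⬝ᵥ (s k).ofLp) := fun k => (hdecr k (hpd k)).1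
  have harmijo : ∀ k, μ * -((g k).ofLp ⬝ᵥ (s k).ofLp) ≤ ‖x k‖ - ‖x (k + 1)‖ := fun k => by
    have h := (hstep k).2.1
    rw [hinner] at h
    simp only [hf] at h
    change ‖x (k + 1)‖ ≤ ‖x k‖ + μ * ((g k).ofLp ⬝ᵥ (s k).ofLp) at h
    linarith
  have hanti : Antitone fun k => ‖x k‖ := antitone_nat_of_succ_le fun k => by
    linarith [harmijo k, mul_pos hμ (hδ k)]
  have hbdd : BddBelow (Set.range fun k => ‖x k‖) := ⟨0, by rintro _ ⟨k, rfl⟩; positivity⟩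
  have hlim := tendsto_atTop_ciInf hanti hbdd
  set r := ⨅ k, ‖x k‖
  have hr : ∀ k, r ≤ ‖x k‖ := fun k => ciInf_le hbdd k
  rcases (Real.iInf_nonneg fun k => norm_nonneg (x k) : 0 ≤ r).eq_or_lt with hr0 | hr0
  · rw [tendsto_zero_iff_norm_tendsto_zero, hr0]
    exact hlim
  exfalso
  have hratio : ∀ k, ((y k).ofLp ⬝ᵥ (y k).ofLp) / ((s k).ofLp ⬝ᵥ (y k).ofLp) ≤ 1 / r := fun k => by
    have hsy := (hdecr k (hpd k)).2.1
    have h := BFGS.inner_sub_normalize_sub (hx0 k) (hx0 (k + 1))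
    rw [← hg, ← hg, ← real_inner_self_eq_norm_sq] at h
    change 2 * inner ℝ (s k) (y k) = (‖x k‖ + ‖x (k + 1)‖) * inner ℝ (y k) (y k) at h
    rw [hinner, hinner] at h
    have hyy : 0 ≤ (y k).ofLp ⬝ᵥ (y k).ofLp := by
      rw [← hinner]
      exact real_inner_self_nonneg
    rw [div_le_div_iff₀ hsy hr0]
    nlinarith [hr k, hr (k + 1)]
  have hδlim : Tendsto (fun k => -((g k).ofLp ⬝ᵥ (s k).ofLp)) atTop (𝓝[>] 0) := by
    refine tendsto_nhdsWithin_iff.2 ⟨?_, .of_forall hδ⟩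
    have hdiff : Tendsto (fun k => μ⁻¹ * (‖x k‖ - ‖x (k + 1)‖)) atTop (𝓝 0) := by
      simpa using (hlim.sub ((tendsto_add_atTop_iff_nat 1).2 hlim)).const_mul μ⁻¹
    refine squeeze_zero (fun k => (hδ k).le) (fun k => ?_) hdiff
    rw [le_inv_mul_iff₀ hμ]
    exact harmijo k
  have hlog := Real.tendsto_log_nhdsGT_zero.comp hδlim
  -- Below this threshold for `log δ`, each step lowers the potential by at least 1.
  obtain ⟨N, hN⟩ := eventually_atTop.1
    (hlog.eventually_le_atBot (Real.log (1 - ν) - 1 / r))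
  have hiter : ∀ m : ℕ, BFGS.potential (H (N + m)) ≤ BFGS.potential (H N) - m := fun m => by
    induction m with
    | zero => simp
    | succ m ih =>
      have h₁ := (hdecr (N + m) (hpd _)).2.2.2
      have h₂ := hN (N + m) (Nat.le_add_right _ _)
      have h₃ := hratio (N + m)
      simp only [Function.comp_apply] at h₂
      push_cast
      rw [← add_assoc]
      linarith
  obtain ⟨m, hm⟩ := exists_nat_gt (BFGS.potential (H N))
  linarith [hiter m, BFGS.potential_nonneg (hpd (N + m))]
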